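/- **Language and logic.** Let $\mathsf{Prop}$ be a set of atomic propositions. $\mathcal L$-formulas are $A ::= p\mid\bot\mid\top\mid A\wedge A\mid A\vee A\mid\Box A\mid\Diamond A$ with $p\in\mathsf{Prop}$. Let $\Sigma$ be a subset of the following set of axioms (each taken for all formulas $A$): (4) $\Diamond\Diamond A\vdash\Diamond A$; (T) $\Box A\vdash A$; (B) $A\vdash\Box\Diamond A$; (D) $\Box A\vdash\Diamond A$; (C) $\Diamond\Box A\vdash\Box\Diamond A$. The logic $\mathbf L.\Sigma$ is the least set of sequents $A\vdash B$ between $\mathcal L$-formulas that contains $\Sigma$ and, for all formulas $A,B$, the sequents $A\vdash A$, $\bot\vdash A$, $A\vdash\top$, $A\vdash A\vee B$, $B\vdash A\vee B$, $A\wedge B\vdash A$, $A\wedge B\vdash B$, $\top\vdash\Box\top$, $\Diamond\bot\vdash\bot$, $\Box A\wedge\Box B\vdash\Box(A\wedge B)$, $\Diamond(A\vee B)\vdash\Diamond A\vee\Diamond B$, and is closed under: from $A\vdash C$ and $C\vdash B$ infer $A\vdash B$; from $A\vdash B$ infer $A(C/p)\vdash B(C/p)$; from $C\vdash A$ and $C\vdash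 B$ infer $C\vdash A\wedge B$; from $A\vdash C$ and $B\vdash C$ infer $A\vee B\vdash C$; from $A\vdash B$ infer $\Box A\vdash\Box B$ and $\Diamond A\vdash\Diamond B$. **Labelled sequents.** Let nominals $\mathbf j,\mathbf h,\mathbf k,\dots$ and conominals $\mathbf m,\dots$ range over two further sets of variables. Terms $\mathbf T$ are $\mathbf j$, $\Diamond\mathbf j$, $\blacklozenge\mathbf j$, $\mathbf m$, $\Box\mathbf m$, $\blacksquare\mathbf m$. A *structure* is a labelled formula $\mathbf j\le A$ or $A\le\mathbf m$, or a pure structure $\mathbf j\le\mathbf T$ (with $\mathbf j$ not in $\mathbf T$) or $\mathbf T\le\mathbf m$ (with $\mathbf m$ not in $\mathbf T$). A labelled sequent $\Gamma\vdash\Delta$ consists of two finite (possibly empty) multisets of structures. A nominal $\mathbf j$ is in display in the structures $\mathbf j\le A$ and $\mathbf j\le\mathbf T$ and in no other; a conominal $\mathbf m$ is in display in the structures $A\le\mathbf m$ and $\mathbf T\le\mathbf m$ and in no other. A labelled formula $\mathbf j\le A$ (resp. $A\le\mathbf m$) is *in display* in a sequent if $\mathbf j$ (resp. $\mathbf m$)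 is in display in every structure of the sequent in which it occurs. **The calculus $\mathbf{A.L}\Sigma$** has the following rules (premises / conclusion), in which all sequents are well formed. * Initial rules: $\mathbf j\le p\vdash\mathbf j\le p$; $p\le\mathbf m\vdash p\le\mathbf m$; $\bot\le\mathbf m\vdash\bot\le\mathbf m$; $\mathbf j\le\top\vdash\mathbf j\le\top$; and, for $A$ of the form $p$, $A_1\wedge A_2$ or $\Box A_1$ and $B$ of the form $p$, $B_1\vee B_2$ or $\Diamond B_1$: $\mathbf j\le\bot\vdash\mathbf j\le A$; $B\le\mathbf m\vdash\bot\le\mathbf m$; $\top\le\mathbf m\vdash B\le\mathbf m$; $\mathbf j\le A\vdash\mathbf j\le\top$. * Cut: $\Gamma\vdash\mathbf j\le A,\Delta$ and $\Gamma',\mathbf j\le A\vdash\Delta'$ / $\Gamma,\Gamma'\vdash\Delta,\Delta'$, and $\Gamma\vdash B\le\mathbf m,\Delta$ and $\Gamma',B\le\mathbf m\vdash\Delta'$ / $\Gamma,\Gamma'\vdash\Delta,\Delta'$, where the two occurrences of the cut formula are in display and are $\mathbf j$-labelled in the first rule and $\mathbf m$-labelled in the second. Here an occurrence of a labelled formula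 in a derivation is $\mathbf j$-labelled (resp. $\mathbf m$-labelled) if, tracing it upwards (through the contexts $\Gamma,\Delta$, and from $C\le\mathbf m$ to $\mathbf j\le C$ and conversely through switch rules), all the topmost occurrences reached were introduced in the form $\mathbf i\le C$ (resp. $C\le\mathbf n$). * Switch rules. (i) $\Gamma,\mathbf j\le A\vdash\mathbf j\le\mathbf m,\Delta$ / $\Gamma\vdash A\le\mathbf m,\Delta$, with $\mathbf j$ not in the conclusion; $\Gamma,A\le\mathbf m\vdash\mathbf j\le\mathbf m,\Delta$ / $\Gamma\vdash\mathbf j\le A,\Delta$, with $\mathbf m$ not in the conclusion. (ii) $\Gamma,\mathbf j\le X\vdash\mathbf j\le Y,\Delta$ / $\Gamma,Y\le\mathbf m\vdash X\le\mathbf m,\Delta$ and $\Gamma,Y\le\mathbf m\vdash X\le\mathbf m,\Delta$ / $\Gamma,\mathbf j\le X\vdash\mathbf j\le Y,\Delta$, where each of $X,Y$ is a formula or a term and $\mathbf j,\mathbf m$ do not occur in $\Gamma,\Delta$. * Adjunction: $\Gamma\vdash\Diamond\mathbf j\le\mathbf m,\Delta$ / $\Gamma\vdash\mathbf j\le\blacksquare\mathbf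 m,\Delta$ and its inverse; $\Gamma\vdash\mathbf j\le\Box\mathbf m,\Delta$ / $\Gamma\vdash\blacklozenge\mathbf j\le\mathbf m,\Delta$ and its inverse. * Structural rules for $\top,\bot$: $\Gamma\vdash\top\le\mathbf m,\Delta$ / $\Gamma,\mathbf j\le\top\vdash\mathbf j\le\Box\mathbf m,\Delta$; $\Gamma\vdash\mathbf j\le\bot,\Delta$ / $\Gamma,\bot\le\mathbf m\vdash\Diamond\mathbf j\le\mathbf m,\Delta$. * Logical rules (in each, the principal labelled formula of the conclusion, i.e. the displayed one containing the new connective, is in display): $\Gamma,\mathbf j\le A_i\vdash\Delta$ / $\Gamma,\mathbf j\le A_1\wedge A_2\vdash\Delta$; $\Gamma\vdash\mathbf j\le A,\Delta$ and $\Gamma\vdash\mathbf j\le B,\Delta$ / $\Gamma\vdash\mathbf j\le A\wedge B,\Delta$; $\Gamma\vdash A\le\mathbf m,\Delta$ and $\Gamma\vdash B\le\mathbf m,\Delta$ / $\Gamma\vdash A\vee B\le\mathbf m,\Delta$; $\Gamma,A_i\le\mathbf m\vdash\Delta$ / $\Gamma,A_1\vee A_2\le\mathbf m\vdash\Delta$;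 $\Gamma\vdash A\le\mathbf m,\Delta$ / $\Gamma,\mathbf j\le\Box A\vdash\mathbf j\le\Box\mathbf m,\Delta$; $\Gamma,A\le\mathbf m\vdash\mathbf j\le\Box\mathbf m,\Delta$ / $\Gamma\vdash\mathbf j\le\Box A,\Delta$ with $\mathbf m$ not in the conclusion; $\Gamma,\mathbf j\le A\vdash\Diamond\mathbf j\le\mathbf m,\Delta$ / $\Gamma\vdash\Diamond A\le\mathbf m,\Delta$ with $\mathbf j$ not in the conclusion; $\Gamma\vdash\mathbf j\le A,\Delta$ / $\Gamma,\Diamond A\le\mathbf m\vdash\Diamond\mathbf j\le\mathbf m,\Delta$. * For each axiom in $\Sigma$ the corresponding rule: (4) $\Gamma\vdash\Diamond\mathbf j\le\mathbf m,\Delta$ / $\Gamma,\mathbf h\le\Diamond\mathbf j\vdash\Diamond\mathbf h\le\mathbf m,\Delta$; (T) $\Gamma\vdash\mathbf j\le\Box\mathbf m,\Delta$ / $\Gamma\vdash\mathbf j\le\mathbf m,\Delta$; (B) $\Gamma\vdash\Diamond\mathbf j\le\mathbf m,\Delta$ / $\Gamma\vdash\mathbf j\le\Box\mathbf m,\Delta$;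 (D) $\Gamma,\mathbf k\le\blacklozenge\mathbf j\vdash\Diamond\mathbf k\le\mathbf m,\Delta$ / $\Gamma\vdash\mathbf j\le\mathbf m,\Delta$; (C) $\Gamma,\mathbf k\le\blacklozenge\mathbf j\vdash\Diamond\mathbf k\le\mathbf m,\Delta$ / $\Gamma,\mathbf h\le\Diamond\mathbf j\vdash\blacklozenge\mathbf h\le\mathbf m,\Delta$; in (D) and (C), $\mathbf k$ does not occur in $\Gamma,\Delta$. **Theorem (conservativity).** For every $\Sigma\subseteq\{(4),(T),(B),(D),(C)\}$, all $\mathcal L$-formulas $A,B$ and every nominal $\mathbf j$: if the labelled sequent $\mathbf j\le A\vdash\mathbf j\le B$ is derivable in $\mathbf{A.L}\Sigma$, then $A\vdash B$ is a theorem of $\mathbf L.\Sigma$. -/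

import Mathlib

namespace NDModal

/-! ## The modal language and the logics `L.S` -/

/-- Formulas of the lattice-based modal language over the set `P` of atomic propositions. -/
inductive Form (P : Type*) where
  | var (p : P) : Form P
  | bot : Form P
  | top : Form P
  | and (A B : Form P) : Form P
  | or (A B : Form P) : Form P
  | box (A : Form P) : Form P
  | dia (A : Form P) : Form P

open Classical in
/-- `A.subst p C` is `A(C/p)`. -/
noncomputable def Form.subst {P : Type*} (p : P) (C : Form P) : Form P → Form P
  | .var q => if q = p then C else .var q
  | .bot => .bot
  | .top => .top
  | .and A B => .and (Form.subst p C A) (Form.subst p C B)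
  | .or A B => .or (Form.subst p C A) (Form.subst p C B)
  | .box A => .box (Form.subst p C A)
  | .dia A => .dia (Form.subst p C A)

/-- Names of the five additional axioms. -/
inductive Axm where
  | ax4 | axT | axB | axD | axC

/-- Left-hand side of the instance of an axiom at the formula `A`. -/
def Axm.lhs {P : Type*} : Axm → Form P → Form P
  | .ax4, A => .dia (.dia A)
  | .axT, A => .box A
  | .axB, A => A
  | .axD, A => .box A
  | .axC, A => .dia (.box A)

/-- Right-hand side of the instance of an axiom at the formula `A`. -/
def Axm.rhs {P : Type*} : Axm → Form P → Form P
  | .ax4, A => .dia A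
  | .axT, A => A
  | .axB, A => .box (.dia A)
  | .axD, A => .dia A
  | .axC, A => .box (.dia A)

/-- `LThm S A B`: the sequent `A ⊢ B` is a theorem of `L.S`, the least set of sequents that
contains the axioms of `L` and the axioms in `S` and is closed under the rules of `L`. -/
inductive LThm {P : Type*} (S : Set Axm) : Form P → Form P → Prop where
  | refl (A : Form P) : LThm S A A
  | bot_le (A : Form P) : LThm S .bot A
  | le_top (A : Form P) : LThm S A .top
  | le_or_left (A B : Form P) : LThm S A (.or A B)
  | le_or_right (A B : Form P) : LThm S B (.or A B)
  | and_le_left (A B : Form P) : LThm S (.and A B) A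
  | and_le_right (A B : Form P) : LThm S (.and A B) B
  | top_le_box : LThm S .top (.box .top)
  | dia_bot_le : LThm S (.dia .bot) .bot
  | box_and (A B : Form P) : LThm S (.and (.box A) (.box B)) (.box (.and A B))
  | dia_or (A B : Form P) : LThm S (.dia (.or A B)) (.or (.dia A) (.dia B))
  | ax (a : Axm) (ha : a ∈ S) (A : Form P) : LThm S (a.lhs A) (a.rhs A)
  | trans {A B C : Form P} : LThm S A C → LThm S C B → LThm S A B
  | subst {A B : Form P} (p : P) (C : Form P) :
      LThm S A B → LThm S (A.subst p C) (B.subst p C)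
  | le_and {A B C : Form P} : LThm S C A → LThm S C B → LThm S C (.and A B)
  | or_le {A B C : Form P} : LThm S A C → LThm S B C → LThm S (.or A B) C
  | box_mono {A B : Form P} : LThm S A B → LThm S (.box A) (.box B)
  | dia_mono {A B : Form P} : LThm S A B → LThm S (.dia A) (.dia B)

/-! ## The language of the labelled calculi

`N` is the set of nominals and `M` is the set of conominals. -/

/-- Terms: the nominal terms `j`, `◇j`, `⧫j` and the conominal terms `m`, `□m`, `■m`. -/
inductive LTerm (N M : Type*) where
  | nom (j : N) : LTerm N M
  | dia (j : N) : LTerm N M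
  | bdia (j : N) : LTerm N M
  | con (m : M) : LTerm N M
  | box (m : M) : LTerm N M
  | bbox (m : M) : LTerm N M

/-- The nominal `j` occurs in a term. -/
def LTerm.HasNom {N M : Type*} (j : N) : LTerm N M → Prop
  | .nom i => i = j
  | .dia i => i = j
  | .bdia i => i = j
  | .con _ => False
  | .box _ => False
  | .bbox _ => False

/-- The conominal `m` occurs in a term. -/
def LTerm.HasCon {N M : Type*} (m : M) : LTerm N M → Prop
  | .nom _ => False
  | .dia _ => False
  | .bdia _ => False
  | .con n => n = m
  | .box n => n = m
  | .bbox n => n = m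

/-- `s ≤ t` is a well-formed pure structure: it is `j ≤ T` with `j` not occurring in `T`, or
`T ≤ m` with `m` not occurring in `T`. -/
def PureWF {N M : Type*} (s t : LTerm N M) : Prop :=
  (∃ j, s = .nom j ∧ ¬ t.HasNom j) ∨ (∃ m, t = .con m ∧ ¬ s.HasCon m)

/-- Structures: labelled formulas `j ≤ A` and `A ≤ m`, and pure structures `s ≤ t`. -/
inductive Struc (P N M : Type*) where
  | nomForm (j : N) (A : Form P) : Struc P N M
  | conForm (A : Form P) (m : M) : Struc P N M
  | pure (s t : LTerm N M) (h : PureWF s t) : Struc P N M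

/-- The nominal `j` occurs in a structure. -/
def Struc.HasNom {P N M : Type*} (j : N) : Struc P N M → Prop
  | .nomForm i _ => i = j
  | .conForm _ _ => False
  | .pure s t _ => s.HasNom j ∨ t.HasNom j

/-- The conominal `m` occurs in a structure. -/
def Struc.HasCon {P N M : Type*} (m : M) : Struc P N M → Prop
  | .nomForm _ _ => False
  | .conForm _ n => n = m
  | .pure s t _ => s.HasCon m ∨ t.HasCon m

/-- The nominal `j` is in display in a structure: the structure is `j ≤ A`, or it is `j ≤ T`
with `j` not occurring in `T`. -/
def Struc.NomDisplayed {P N M : Type*} (j : N) : Struc P N M → Prop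
  | .nomForm i _ => i = j
  | .conForm _ _ => False
  | .pure s t _ => s = .nom j ∧ ¬ t.HasNom j

/-- The conominal `m` is in display in a structure: the structure is `A ≤ m`, or it is `T ≤ m`
with `m` not occurring in `T`. -/
def Struc.ConDisplayed {P N M : Type*} (m : M) : Struc P N M → Prop
  | .nomForm _ _ => False
  | .conForm _ n => n = m
  | .pure s t _ => t = .con m ∧ ¬ s.HasCon m

/-- Marks carried by the occurrences of labelled formulas in a derivation. They implement the
side condition of the cut rules that the cut formula is `j`-labelled (respectively `m`-labelled),
i.e. that all the uppermost occurrences congruent to it were introduced with a nominal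
(respectively conominal) label. A mark is chosen where an occurrence is introduced, and every rule
passes it on unchanged to the congruent occurrence in the conclusion. An occurrence introduced as
`j ≤ A` may be marked `jLab` or `free`; an occurrence introduced as `A ≤ m` may be marked `mLab` or
`free`. So an occurrence can bear the mark `jLab` (`mLab`) exactly when it is a `j`-labelled
(`m`-labelled) formula; only the formulas to be cut need a mark other than `free`. -/
inductive Mark where
  | jLab | mLab | free

/-- Marked occurrences of structures (the mark of a pure structure is always `free`). -/
abbrev Occ (P N M : Type*) := Struc P N M × Mark

section Occurrences

variable {P N M : Type*}

/-- `j ≤ A` with mark `o`. -/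
def jForm (j : N) (A : Form P) (o : Mark) : Occ P N M := (.nomForm j A, o)

/-- `A ≤ m` with mark `o`. -/
def mForm (A : Form P) (m : M) (o : Mark) : Occ P N M := (.conForm A m, o)

/-- The pure structure `j ≤ T`. -/
def jTerm (j : N) (T : LTerm N M) (h : ¬ T.HasNom j) : Occ P N M :=
  (.pure (.nom j) T (Or.inl ⟨j, rfl, h⟩), .free)

/-- The pure structure `T ≤ m`. -/
def mTerm (T : LTerm N M) (m : M) (h : ¬ T.HasCon m) : Occ P N M :=
  (.pure T (.con m) (Or.inr ⟨m, rfl, h⟩), .free)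

/-- `j ≤ m` -/
def jLeM (j : N) (m : M) : Occ P N M := jTerm j (.con m) (fun h => h)

/-- `j ≤ □m` -/
def jLeBox (j : N) (m : M) : Occ P N M := jTerm j (.box m) (fun h => h)

/-- `j ≤ ■m` -/
def jLeBBox (j : N) (m : M) : Occ P N M := jTerm j (.bbox m) (fun h => h)

/-- `◇j ≤ m` -/
def diaLeM (j : N) (m : M) : Occ P N M := mTerm (.dia j) m (fun h => h)

/-- `⧫j ≤ m` -/
def bdiaLeM (j : N) (m : M) : Occ P N M := mTerm (.bdia j) m (fun h => h)

/-- `h ≤ ◇j`, for `h` different from `j` -/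
def jLeDia (h j : N) (hj : j ≠ h) : Occ P N M := jTerm h (.dia j) hj

/-- `h ≤ ⧫j`, for `h` different from `j` -/
def jLeBDia (h j : N) (hj : j ≠ h) : Occ P N M := jTerm h (.bdia j) hj

/-- The nominal `j` does not occur in the sequent `Γ ⊢ Δ`. -/
def NomFresh (j : N) (Γ Δ : Multiset (Occ P N M)) : Prop :=
  ∀ x ∈ Γ + Δ, ¬ x.1.HasNom j

/-- The conominal `m` does not occur in the sequent `Γ ⊢ Δ`. -/
def ConFresh (m : M) (Γ Δ : Multiset (Occ P N M)) : Prop :=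
  ∀ x ∈ Γ + Δ, ¬ x.1.HasCon m

/-- The nominal `j` is in display in each structure of `Γ ⊢ Δ` in which it occurs; that is,
labelled formulas `j ≤ A` are in display in `Γ ⊢ Δ`. -/
def NomInDisplay (j : N) (Γ Δ : Multiset (Occ P N M)) : Prop :=
  ∀ x ∈ Γ + Δ, x.1.HasNom j → x.1.NomDisplayed j

/-- The conominal `m` is in display in each structure of `Γ ⊢ Δ` in which it occurs; that is,
labelled formulas `A ≤ m` are in display in `Γ ⊢ Δ`. -/
def ConInDisplay (m : M) (Γ Δ : Multiset (Occ P N M)) : Prop :=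
  ∀ x ∈ Γ + Δ, x.1.HasCon m → x.1.ConDisplayed m

end Occurrences

/-! ## The labelled calculi `A.LS` -/

/-- The formulas allowed in the initial rules `⊥_j` and `⊤_j`: `p`, `A₁ ∧ A₂`, `□A₁`. -/
def Form.JShape {P : Type*} : Form P → Prop
  | .var _ => True
  | .and _ _ => True
  | .box _ => True
  | _ => False

/-- The formulas allowed in the initial rules `⊥_m` and `⊤_m`: `p`, `B₁ ∨ B₂`, `◇B₁`. -/
def Form.MShape {P : Type*} : Form P → Prop
  | .var _ => True
  | .or _ _ => True
  | .dia _ => True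
  | _ => False

/-- `Deriv S Γ Δ`: the (marked) sequent `Γ ⊢ Δ` is derivable in `A.LS`. Antecedents and
consequents are finite, possibly empty, multisets of structures. -/
inductive Deriv {P N M : Type*} (S : Set Axm) :
    Multiset (Occ P N M) → Multiset (Occ P N M) → Prop where
  -- initial rules
  | id_j (j : N) (p : P) (o o' : Mark) (ho : o ≠ .mLab) (ho' : o' ≠ .mLab) :
      Deriv S {jForm j (.var p) o} {jForm j (.var p) o'}
  | id_m (m : M) (p : P) (o o' : Mark) (ho : o ≠ .jLab) (ho' : o' ≠ .jLab) :
      Deriv S {mForm (.var p) m o} {mForm (.var p) m o'}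
  | id_bot (m : M) (o o' : Mark) (ho : o ≠ .jLab) (ho' : o' ≠ .jLab) :
      Deriv S {mForm .bot m o} {mForm .bot m o'}
  | id_top (j : N) (o o' : Mark) (ho : o ≠ .mLab) (ho' : o' ≠ .mLab) :
      Deriv S {jForm j .top o} {jForm j .top o'}
  -- initial rules for top and bottom
  | bot_j (j : N) (A : Form P) (hA : A.JShape) (o o' : Mark) (ho : o ≠ .mLab) (ho' : o' ≠ .mLab) :
      Deriv S {jForm j .bot o} {jForm j A o'}
  | bot_m (m : M) (B : Form P) (hB : B.MShape) (o o' : Mark) (ho : o ≠ .jLab) (ho' : o' ≠ .jLab) :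
      Deriv S {mForm B m o} {mForm .bot m o'}
  | top_m (m : M) (B : Form P) (hB : B.MShape) (o o' : Mark) (ho : o ≠ .jLab) (ho' : o' ≠ .jLab) :
      Deriv S {mForm .top m o} {mForm B m o'}
  | top_j (j : N) (A : Form P) (hA : A.JShape) (o o' : Mark) (ho : o ≠ .mLab) (ho' : o' ≠ .mLab) :
      Deriv S {jForm j A o} {jForm j .top o'}
  -- cut rules
  | cut_j {Γ Δ Γ' Δ'} (j : N) (A : Form P) :
      Deriv S Γ (jForm j A .jLab ::ₘ Δ) →
      Deriv S (jForm j A .jLab ::ₘ Γ') Δ' →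
      NomInDisplay j Γ (jForm j A .jLab ::ₘ Δ) →
      NomInDisplay j (jForm j A .jLab ::ₘ Γ') Δ' →
      Deriv S (Γ + Γ') (Δ + Δ')
  | cut_m {Γ Δ Γ' Δ'} (B : Form P) (m : M) :
      Deriv S Γ (mForm B m .mLab ::ₘ Δ) →
      Deriv S (mForm B m .mLab ::ₘ Γ') Δ' →
      ConInDisplay m Γ (mForm B m .mLab ::ₘ Δ) →
      ConInDisplay m (mForm B m .mLab ::ₘ Γ') Δ' →
      Deriv S (Γ + Γ') (Δ + Δ')
  -- switch rules
  | s_m {Γ Δ} (j : N) (m : M) (A : Form P) (o : Mark) :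
      Deriv S (jForm j A o ::ₘ Γ) (jLeM j m ::ₘ Δ) → NomFresh j Γ Δ →
      Deriv S Γ (mForm A m o ::ₘ Δ)
  | s_j {Γ Δ} (j : N) (m : M) (A : Form P) (o : Mark) :
      Deriv S (mForm A m o ::ₘ Γ) (jLeM j m ::ₘ Δ) → ConFresh m Γ Δ →
      Deriv S Γ (jForm j A o ::ₘ Δ)
  | s_mm {Γ Δ} (j : N) (m : M) (A B : Form P) (o o' : Mark) :
      Deriv S (jForm j A o ::ₘ Γ) (jForm j B o' ::ₘ Δ) → NomFresh j Γ Δ → ConFresh m Γ Δ →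
      Deriv S (mForm B m o' ::ₘ Γ) (mForm A m o ::ₘ Δ)
  | s_jj {Γ Δ} (j : N) (m : M) (A B : Form P) (o o' : Mark) :
      Deriv S (mForm A m o ::ₘ Γ) (mForm B m o' ::ₘ Δ) → NomFresh j Γ Δ → ConFresh m Γ Δ →
      Deriv S (jForm j B o' ::ₘ Γ) (jForm j A o ::ₘ Δ)
  | s_mT {Γ Δ} (j : N) (m : M) (A : Form P) (o : Mark) (T : LTerm N M)
      (hj : ¬ T.HasNom j) (hm : ¬ T.HasCon m) :
      Deriv S (jTerm j T hj ::ₘ Γ) (jForm j A o ::ₘ Δ) → NomFresh j Γ Δ → ConFresh m Γ Δ →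
      Deriv S (mForm A m o ::ₘ Γ) (mTerm T m hm ::ₘ Δ)
  | s_jT {Γ Δ} (j : N) (m : M) (A : Form P) (o : Mark) (T : LTerm N M)
      (hj : ¬ T.HasNom j) (hm : ¬ T.HasCon m) :
      Deriv S (mTerm T m hm ::ₘ Γ) (mForm A m o ::ₘ Δ) → NomFresh j Γ Δ → ConFresh m Γ Δ →
      Deriv S (jForm j A o ::ₘ Γ) (jTerm j T hj ::ₘ Δ)
  | s_Tm {Γ Δ} (j : N) (m : M) (A : Form P) (o : Mark) (T : LTerm N M)
      (hj : ¬ T.HasNom j) (hm : ¬ T.HasCon m) :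
      Deriv S (jForm j A o ::ₘ Γ) (jTerm j T hj ::ₘ Δ) → NomFresh j Γ Δ → ConFresh m Γ Δ →
      Deriv S (mTerm T m hm ::ₘ Γ) (mForm A m o ::ₘ Δ)
  | s_Tj {Γ Δ} (j : N) (m : M) (A : Form P) (o : Mark) (T : LTerm N M)
      (hj : ¬ T.HasNom j) (hm : ¬ T.HasCon m) :
      Deriv S (mForm A m o ::ₘ Γ) (mTerm T m hm ::ₘ Δ) → NomFresh j Γ Δ → ConFresh m Γ Δ →
      Deriv S (jTerm j T hj ::ₘ Γ) (jForm j A o ::ₘ Δ)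
  | s_TTm {Γ Δ} (j : N) (m : M) (T T' : LTerm N M)
      (hj : ¬ T.HasNom j) (hm : ¬ T.HasCon m) (hj' : ¬ T'.HasNom j) (hm' : ¬ T'.HasCon m) :
      Deriv S (jTerm j T' hj' ::ₘ Γ) (jTerm j T hj ::ₘ Δ) → NomFresh j Γ Δ → ConFresh m Γ Δ →
      Deriv S (mTerm T m hm ::ₘ Γ) (mTerm T' m hm' ::ₘ Δ)
  | s_jTT {Γ Δ} (j : N) (m : M) (T T' : LTerm N M)
      (hj : ¬ T.HasNom j) (hm : ¬ T.HasCon m) (hj' : ¬ T'.HasNom j) (hm' : ¬ T'.HasCon m) :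
      Deriv S (mTerm T' m hm' ::ₘ Γ) (mTerm T m hm ::ₘ Δ) → NomFresh j Γ Δ → ConFresh m Γ Δ →
      Deriv S (jTerm j T hj ::ₘ Γ) (jTerm j T' hj' ::ₘ Δ)
  -- adjunction rules
  | adj_dia {Γ Δ} (j : N) (m : M) :
      Deriv S Γ (diaLeM j m ::ₘ Δ) → Deriv S Γ (jLeBBox j m ::ₘ Δ)
  | adj_dia_inv {Γ Δ} (j : N) (m : M) :
      Deriv S Γ (jLeBBox j m ::ₘ Δ) → Deriv S Γ (diaLeM j m ::ₘ Δ)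
  | adj_box {Γ Δ} (j : N) (m : M) :
      Deriv S Γ (jLeBox j m ::ₘ Δ) → Deriv S Γ (bdiaLeM j m ::ₘ Δ)
  | adj_box_inv {Γ Δ} (j : N) (m : M) :
      Deriv S Γ (bdiaLeM j m ::ₘ Δ) → Deriv S Γ (jLeBox j m ::ₘ Δ)
  -- structural rules for top and bottom
  | top_box {Γ Δ} (j : N) (m : M) (o o' : Mark) (ho' : o' ≠ .mLab) :
      Deriv S Γ (mForm .top m o ::ₘ Δ) →
      Deriv S (jForm j .top o' ::ₘ Γ) (jLeBox j m ::ₘ Δ)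
  | bot_dia {Γ Δ} (j : N) (m : M) (o o' : Mark) (ho' : o' ≠ .jLab) :
      Deriv S Γ (jForm j .bot o ::ₘ Δ) →
      Deriv S (mForm .bot m o' ::ₘ Γ) (diaLeM j m ::ₘ Δ)
  -- logical rules for the propositional connectives
  | and_P_left {Γ Δ} (j : N) (A B : Form P) (o o' : Mark) (ho' : o' ≠ .mLab) :
      Deriv S (jForm j A o ::ₘ Γ) Δ →
      NomInDisplay j (jForm j (.and A B) o' ::ₘ Γ) Δ →
      Deriv S (jForm j (.and A B) o' ::ₘ Γ) Δ
  | and_P_right {Γ Δ} (j : N) (A B : Form P) (o o' : Mark) (ho' : o' ≠ .mLab) :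
      Deriv S (jForm j B o ::ₘ Γ) Δ →
      NomInDisplay j (jForm j (.and A B) o' ::ₘ Γ) Δ →
      Deriv S (jForm j (.and A B) o' ::ₘ Γ) Δ
  | and_S {Γ Δ} (j : N) (A B : Form P) (o₁ o₂ o' : Mark) (ho' : o' ≠ .mLab) :
      Deriv S Γ (jForm j A o₁ ::ₘ Δ) →
      Deriv S Γ (jForm j B o₂ ::ₘ Δ) →
      NomInDisplay j Γ (jForm j (.and A B) o' ::ₘ Δ) →
      Deriv S Γ (jForm j (.and A B) o' ::ₘ Δ)
  | or_P {Γ Δ} (m : M) (A B : Form P) (o₁ o₂ o' : Mark) (ho' : o' ≠ .jLab) :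
      Deriv S Γ (mForm A m o₁ ::ₘ Δ) →
      Deriv S Γ (mForm B m o₂ ::ₘ Δ) →
      ConInDisplay m Γ (mForm (.or A B) m o' ::ₘ Δ) →
      Deriv S Γ (mForm (.or A B) m o' ::ₘ Δ)
  | or_S_left {Γ Δ} (m : M) (A B : Form P) (o o' : Mark) (ho' : o' ≠ .jLab) :
      Deriv S (mForm A m o ::ₘ Γ) Δ →
      ConInDisplay m (mForm (.or A B) m o' ::ₘ Γ) Δ →
      Deriv S (mForm (.or A B) m o' ::ₘ Γ) Δ
  | or_S_right {Γ Δ} (m : M) (A B : Form P) (o o' : Mark) (ho' : o' ≠ .jLab) :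
      Deriv S (mForm B m o ::ₘ Γ) Δ →
      ConInDisplay m (mForm (.or A B) m o' ::ₘ Γ) Δ →
      Deriv S (mForm (.or A B) m o' ::ₘ Γ) Δ
  -- logical rules for the modalities
  | box_P {Γ Δ} (j : N) (m : M) (A : Form P) (o o' : Mark) (ho' : o' ≠ .mLab) :
      Deriv S Γ (mForm A m o ::ₘ Δ) →
      NomInDisplay j (jForm j (.box A) o' ::ₘ Γ) (jLeBox j m ::ₘ Δ) →
      Deriv S (jForm j (.box A) o' ::ₘ Γ) (jLeBox j m ::ₘ Δ)
  | box_S {Γ Δ} (j : N) (m : M) (A : Form P) (o o' : Mark) (ho' : o' ≠ .mLab) :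
      Deriv S (mForm A m o ::ₘ Γ) (jLeBox j m ::ₘ Δ) →
      ConFresh m Γ Δ →
      NomInDisplay j Γ (jForm j (.box A) o' ::ₘ Δ) →
      Deriv S Γ (jForm j (.box A) o' ::ₘ Δ)
  | dia_P {Γ Δ} (j : N) (m : M) (A : Form P) (o o' : Mark) (ho' : o' ≠ .jLab) :
      Deriv S (jForm j A o ::ₘ Γ) (diaLeM j m ::ₘ Δ) →
      NomFresh j Γ Δ →
      ConInDisplay m Γ (mForm (.dia A) m o' ::ₘ Δ) →
      Deriv S Γ (mForm (.dia A) m o' ::ₘ Δ)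
  | dia_S {Γ Δ} (j : N) (m : M) (A : Form P) (o o' : Mark) (ho' : o' ≠ .jLab) :
      Deriv S Γ (jForm j A o ::ₘ Δ) →
      ConInDisplay m (mForm (.dia A) m o' ::ₘ Γ) (diaLeM j m ::ₘ Δ) →
      Deriv S (mForm (.dia A) m o' ::ₘ Γ) (diaLeM j m ::ₘ Δ)
  -- rules for the additional axioms
  | rule4 {Γ Δ} (hS : Axm.ax4 ∈ S) (h j : N) (m : M) (hj : j ≠ h) :
      Deriv S Γ (diaLeM j m ::ₘ Δ) →
      Deriv S (jLeDia h j hj ::ₘ Γ) (diaLeM h m ::ₘ Δ)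
  | ruleT {Γ Δ} (hS : Axm.axT ∈ S) (j : N) (m : M) :
      Deriv S Γ (jLeBox j m ::ₘ Δ) → Deriv S Γ (jLeM j m ::ₘ Δ)
  | ruleB {Γ Δ} (hS : Axm.axB ∈ S) (j : N) (m : M) :
      Deriv S Γ (diaLeM j m ::ₘ Δ) → Deriv S Γ (jLeBox j m ::ₘ Δ)
  | ruleD {Γ Δ} (hS : Axm.axD ∈ S) (k j : N) (m : M) (hk : j ≠ k) :
      Deriv S (jLeBDia k j hk ::ₘ Γ) (diaLeM k m ::ₘ Δ) → NomFresh k Γ Δ →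
      Deriv S Γ (jLeM j m ::ₘ Δ)
  | ruleC {Γ Δ} (hS : Axm.axC ∈ S) (k h j : N) (m : M) (hk : j ≠ k) (hj : j ≠ h) :
      Deriv S (jLeBDia k j hk ::ₘ Γ) (diaLeM k m ::ₘ Δ) → NomFresh k Γ Δ →
      Deriv S (jLeDia h j hj ::ₘ Γ) (bdiaLeM h m ::ₘ Δ)

/-- Derivability of the sequent `Γ ⊢ Δ` in `A.LS`: it has a derivation for some choice of marks. -/
def Derivable {P N M : Type*} (S : Set Axm) (Γ Δ : Multiset (Struc P N M)) : Prop :=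
  ∃ Γ' Δ' : Multiset (Occ P N M),
    Γ'.map Prod.fst = Γ ∧ Δ'.map Prod.fst = Δ ∧ Deriv S Γ' Δ'

end NDModal

/-! Conservativity follows from soundness in a model built from `L.S` itself, without cut
elimination. The Lindenbaum algebra of `L.S` need not have the adjoints ⧫ and ■, but its canonical
extension does. Only closed and open elements of that extension are needed, and these are filters
and ideals of formulas. A nominal denotes a filter, a conominal an ideal, a formula its principal
filter. A sequent is read classically: under each assignment, if all structures on the left hold,
some structure on the right holds.

Two properties of the extension carry soundness (`Deriv.sound`). Density (`Val.le_of_forall_filter`,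
`Val.le_of_forall_ideal`) validates the switch rules, where a fresh variable ranges over all filters
or all ideals. Compactness, by which a filter lies below an ideal exactly when they share a formula,
turns the modal structures into statements about a single formula. The logical, adjunction and axiom
rules then reduce to membership and to theorems of `L.S`.

Finally, if `j` denotes the principal filter of `A`, then `j ≤ A` holds and the truth of `j ≤ B` is
exactly provability of `A ⊢ B`. -/

namespace NDModal

/-! ## Filters and ideals of the Lindenbaum algebra of `L.S`

Nominals are interpreted as filters and conominals as ideals of the Lindenbaum algebra of `L.S`,
ordered as elements of its canonical extension. -/

/-- Filters of the preorder of formulas given by provability in `L.S`. -/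
structure FormFilter (P : Type*) (S : Set Axm) where
  carrier : Set (Form P)
  top_mem : .top ∈ carrier
  and_mem {A B : Form P} : A ∈ carrier → B ∈ carrier → .and A B ∈ carrier
  mem_of_thm {A B : Form P} : A ∈ carrier → LThm S A B → B ∈ carrier

/-- Ideals of the preorder of formulas given by provability in `L.S`. -/
structure FormIdeal (P : Type*) (S : Set Axm) where
  carrier : Set (Form P)
  bot_mem : .bot ∈ carrier
  or_mem {A B : Form P} : A ∈ carrier → B ∈ carrier → .or A B ∈ carrier
  mem_of_thm {A B : Form P} : B ∈ carrier → LThm S A B → A ∈ carrier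

section Semantics

variable {P N M : Type*} {S : Set Axm}

/-- The filter of consequences of `A`. -/
def FormFilter.principal (S : Set Axm) (A : Form P) : FormFilter P S where
  carrier := {B | LThm S A B}
  top_mem := .le_top A
  and_mem h h' := .le_and h h'
  mem_of_thm h h' := .trans h h'

/-- The ideal of formulas that imply `A`. -/
def FormIdeal.principal (S : Set Axm) (A : Form P) : FormIdeal P S where
  carrier := {B | LThm S B A}
  bot_mem := .bot_le A
  or_mem h h' := .or_le h h'
  mem_of_thm h h' := .trans h' h

/-- The filter generated by the formulas `◇A` with `A` in `F`. -/
def FormFilter.dia (F : FormFilter P S) : FormFilter P S where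
  carrier := {B | ∃ A ∈ F.carrier, LThm S (.dia A) B}
  top_mem := ⟨.top, F.top_mem, .le_top _⟩
  -- Monotonicity of ◇ suffices: ◇(A' ∧ B') lies below both ◇A' and ◇B'.
  and_mem := by
    rintro A B ⟨A', hA', hA⟩ ⟨B', hB', hB⟩
    exact ⟨_, F.and_mem hA' hB', .le_and (.trans (.dia_mono (.and_le_left _ _)) hA)
      (.trans (.dia_mono (.and_le_right _ _)) hB)⟩
  mem_of_thm := by
    rintro A B ⟨A', hA', hA⟩ h
    exact ⟨A', hA', .trans hA h⟩

/-- The filter of the formulas `A` with `□A` in `F`. -/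
def FormFilter.bdia (F : FormFilter P S) : FormFilter P S where
  carrier := {A | .box A ∈ F.carrier}
  -- Normality of □ is what makes the preimage of a filter under □ a filter.
  top_mem := F.mem_of_thm F.top_mem .top_le_box
  and_mem h h' := F.mem_of_thm (F.and_mem h h') (.box_and _ _)
  mem_of_thm h h' := F.mem_of_thm h (.box_mono h')

/-- The ideal generated by the formulas `□A` with `A` in `I`. -/
def FormIdeal.box (I : FormIdeal P S) : FormIdeal P S where
  carrier := {B | ∃ A ∈ I.carrier, LThm S B (.box A)}
  bot_mem := ⟨.bot, I.bot_mem, .bot_le _⟩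
  or_mem := by
    rintro A B ⟨A', hA', hA⟩ ⟨B', hB', hB⟩
    exact ⟨_, I.or_mem hA' hB', .or_le (.trans hA (.box_mono (.le_or_left _ _)))
      (.trans hB (.box_mono (.le_or_right _ _)))⟩
  mem_of_thm := by
    rintro A B ⟨A', hA', hA⟩ h
    exact ⟨A', hA', .trans h hA⟩

/-- The ideal of the formulas `A` with `◇A` in `I`. -/
def FormIdeal.bbox (I : FormIdeal P S) : FormIdeal P S where
  carrier := {A | .dia A ∈ I.carrier}
  bot_mem := I.mem_of_thm I.bot_mem .dia_bot_le
  or_mem h h' := I.mem_of_thm (I.or_mem h h') (.dia_or _ _)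
  mem_of_thm h h' := I.mem_of_thm h (.dia_mono h')

/-! ### Order, density and the values of formulas -/

/-- Closed elements (filters) and open elements (ideals) of the canonical extension. -/
inductive Val (P : Type*) (S : Set Axm) where
  | filter (F : FormFilter P S) : Val P S
  | ideal (I : FormIdeal P S) : Val P S

/-- The order of the canonical extension on closed and open elements. -/
def Val.Le : Val P S → Val P S → Prop
  -- A filter stands for the meet of its members and an ideal for the join of its members. Hence
  -- inclusion is reversed on filters, and `F ≤ I` reduces by compactness to a common formula.
  | .filter F, .filter G => G.carrier ⊆ F.carrier
  | .filter F, .ideal I => ∃ A ∈ F.carrier, A ∈ I.carrier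
  | .ideal I, .ideal J => I.carrier ⊆ J.carrier
  | .ideal I, .filter F => ∀ A ∈ I.carrier, ∀ B ∈ F.carrier, LThm S A B

/-- The mixed cases pass through a common formula: if `F ≤ I ≤ G`, a formula in both `F` and `I`
lies below every member of `G`, so `F` contains `G`. -/
theorem Val.Le.trans {x y z : Val P S} (h : x.Le y) (h' : y.Le z) : x.Le z := by
  match x, y, z with
  | .filter F, .filter G, .filter H => exact fun A hA => h (h' hA)
  | .filter F, .filter G, .ideal I =>
    obtain ⟨A, hA, hI⟩ := h'
    exact ⟨A, h hA, hI⟩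
  | .filter F, .ideal I, .filter G =>
    obtain ⟨A, hA, hI⟩ := h
    exact fun B hB => F.mem_of_thm hA (h' A hI B hB)
  | .filter F, .ideal I, .ideal J =>
    obtain ⟨A, hA, hI⟩ := h
    exact ⟨A, hA, h' hI⟩
  | .ideal I, .filter F, .filter G => exact fun A hA B hB => h A hA B (h' hB)
  | .ideal I, .filter F, .ideal J =>
    obtain ⟨B, hB, hJ⟩ := h'
    exact fun A hA => J.mem_of_thm hJ (h A hA B hB)
  | .ideal I, .ideal J, .filter F => exact fun A hA B hB => h' A (h hA) B hB
  | .ideal I, .ideal J, .ideal K => exact fun A hA => h' (h hA)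

/-- Filters are join-dense. -/
theorem Val.le_of_forall_filter {x y : Val P S}
    (h : ∀ F, (Val.filter F).Le x → (Val.filter F).Le y) : x.Le y := by
  match x, y with
  | .filter F, y => exact h F (fun _ hA => hA)
  | .ideal I, .filter G =>
    -- For `A` in `I`, the principal filter of `A` lies below `I`, with `A` as common formula.
    -- Testing on these filters is enough.
    exact fun A hA B hB => h (.principal S A) ⟨A, .refl A, hA⟩ hB
  | .ideal I, .ideal J =>
    intro A hA
    obtain ⟨B, hB, hJ⟩ := h (.principal S A) ⟨A, .refl A, hA⟩
    exact J.mem_of_thm hJ hB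

/-- Ideals are meet-dense. -/
theorem Val.le_of_forall_ideal {x y : Val P S}
    (h : ∀ I, y.Le (Val.ideal I) → x.Le (Val.ideal I)) : x.Le y := by
  match x, y with
  | x, .ideal I => exact h I (fun _ hA => hA)
  | .ideal I, .filter G =>
    exact fun A hA B hB => h (.principal S B) ⟨B, hB, .refl B⟩ hA
  | .filter F, .filter G =>
    intro B hB
    obtain ⟨A, hA, hI⟩ := h (.principal S B) ⟨B, hB, .refl B⟩
    exact F.mem_of_thm hA hI

/-- The element of the canonical extension given by a formula. -/
def Form.val (S : Set Axm) (A : Form P) : Val P S := .filter (.principal S A)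

/-- Formulas are both closed and open: although valued as principal filters, they behave against
ideals as principal ideals do. Labelled formulas on either side thus become membership. -/
theorem Val.filter_le_form {F : FormFilter P S} {A : Form P} :
    (Val.filter F).Le (A.val S) ↔ A ∈ F.carrier :=
  ⟨fun h => h (LThm.refl A), fun h _ hB => F.mem_of_thm h hB⟩

theorem Val.form_le_ideal {I : FormIdeal P S} {A : Form P} :
    (A.val S).Le (.ideal I) ↔ A ∈ I.carrier :=
  ⟨fun ⟨_, hB, hI⟩ => I.mem_of_thm hI hB, fun h => ⟨A, .refl A, h⟩⟩

/-! ### Truth of structures and sequents -/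

/-- The value of a term. -/
def LTerm.val (f : N → FormFilter P S) (g : M → FormIdeal P S) : LTerm N M → Val P S
  | .nom j => .filter (f j)
  | .dia j => .filter (f j).dia
  | .bdia j => .filter (f j).bdia
  | .con m => .ideal (g m)
  | .box m => .ideal (g m).box
  | .bbox m => .ideal (g m).bbox

/-- Truth of a structure. -/
def Struc.Sat (f : N → FormFilter P S) (g : M → FormIdeal P S) : Struc P N M → Prop
  | .nomForm j A => (Val.filter (f j)).Le (A.val S)
  | .conForm A m => (A.val S).Le (.ideal (g m))
  | .pure s t _ => (s.val f g).Le (t.val f g)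

/-- Truth of all structures of an antecedent. -/
def AllSat (f : N → FormFilter P S) (g : M → FormIdeal P S) (Γ : Multiset (Occ P N M)) : Prop :=
  ∀ x ∈ Γ, x.1.Sat f g

/-- Truth of some structure of a consequent. -/
def AnySat (f : N → FormFilter P S) (g : M → FormIdeal P S) (Δ : Multiset (Occ P N M)) : Prop :=
  ∃ x ∈ Δ, x.1.Sat f g

variable {f : N → FormFilter P S} {g : M → FormIdeal P S}

theorem allSat_cons {x : Occ P N M} {Γ : Multiset (Occ P N M)} :
    AllSat f g (x ::ₘ Γ) ↔ x.1.Sat f g ∧ AllSat f g Γ := by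
  simp [AllSat]

theorem anySat_cons {x : Occ P N M} {Δ : Multiset (Occ P N M)} :
    AnySat f g (x ::ₘ Δ) ↔ x.1.Sat f g ∨ AnySat f g Δ := by
  simp [AnySat]

theorem allSat_add {Γ Γ' : Multiset (Occ P N M)} :
    AllSat f g (Γ + Γ') ↔ AllSat f g Γ ∧ AllSat f g Γ' := by
  simp [AllSat, or_imp, forall_and]

theorem anySat_add {Δ Δ' : Multiset (Occ P N M)} :
    AnySat f g (Δ + Δ') ↔ AnySat f g Δ ∨ AnySat f g Δ' := by
  simp [AnySat, or_and_right, exists_or]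

theorem allSat_singleton {x : Occ P N M} : AllSat f g {x} ↔ x.1.Sat f g := by
  simp [AllSat]

theorem anySat_singleton {x : Occ P N M} : AnySat f g {x} ↔ x.1.Sat f g := by
  simp [AnySat]

/-! ### Reassigning a fresh variable -/

open Classical in
/-- The assignment `f` with the value at `a` changed to `b`. -/
noncomputable def assign {α β : Type*} (f : α → β) (a : α) (b : β) : α → β := Function.update f a b

theorem assign_self {α β : Type*} (f : α → β) (a : α) (b : β) : assign f a b a = b := by
  simp [assign]

theorem assign_of_ne {α β : Type*} (f : α → β) {a a' : α} (b : β) (h : a' ≠ a) :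
    assign f a b a' = f a' := by
  simp [assign, h]

theorem LTerm.val_assign_nom {j : N} {F : FormFilter P S} {T : LTerm N M} (h : ¬ T.HasNom j) :
    T.val (assign f j F) g = T.val f g := by
  cases T <;> first | rfl | (simp only [LTerm.val, assign_of_ne f F h])

theorem LTerm.val_assign_con {m : M} {I : FormIdeal P S} {T : LTerm N M} (h : ¬ T.HasCon m) :
    T.val f (assign g m I) = T.val f g := by
  cases T <;> first | rfl | (simp only [LTerm.val, assign_of_ne g I h])

theorem Struc.sat_assign_nom {j : N} {F : FormFilter P S} {x : Struc P N M} (h : ¬ x.HasNom j) :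
    x.Sat (assign f j F) g ↔ x.Sat f g := by
  cases x with
  | nomForm i A => simp only [Struc.Sat, assign_of_ne f F h]
  | conForm A m => rfl
  | pure s t _ =>
    have h' := not_or.mp h
    simp only [Struc.Sat, LTerm.val_assign_nom h'.1, LTerm.val_assign_nom h'.2]

theorem Struc.sat_assign_con {m : M} {I : FormIdeal P S} {x : Struc P N M} (h : ¬ x.HasCon m) :
    x.Sat f (assign g m I) ↔ x.Sat f g := by
  cases x with
  | nomForm i A => rfl
  | conForm A n => simp only [Struc.Sat, assign_of_ne g I h]
  | pure s t _ =>
    have h' := not_or.mp h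
    simp only [Struc.Sat, LTerm.val_assign_con h'.1, LTerm.val_assign_con h'.2]

variable {Γ Δ : Multiset (Occ P N M)}

theorem NomFresh.allSat {j : N} (h : NomFresh j Γ Δ) (F : FormFilter P S) :
    AllSat (assign f j F) g Γ ↔ AllSat f g Γ :=
  forall₂_congr fun x hx => Struc.sat_assign_nom (h x (Multiset.mem_add.2 (.inl hx)))

theorem NomFresh.anySat {j : N} (h : NomFresh j Γ Δ) (F : FormFilter P S) :
    AnySat (assign f j F) g Δ ↔ AnySat f g Δ :=
  exists_congr fun x => and_congr_right fun hx =>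
    Struc.sat_assign_nom (h x (Multiset.mem_add.2 (.inr hx)))

theorem ConFresh.allSat {m : M} (h : ConFresh m Γ Δ) (I : FormIdeal P S) :
    AllSat f (assign g m I) Γ ↔ AllSat f g Γ :=
  forall₂_congr fun x hx => Struc.sat_assign_con (h x (Multiset.mem_add.2 (.inl hx)))

theorem ConFresh.anySat {m : M} (h : ConFresh m Γ Δ) (I : FormIdeal P S) :
    AnySat f (assign g m I) Δ ↔ AnySat f g Δ :=
  exists_congr fun x => and_congr_right fun hx =>
    Struc.sat_assign_con (h x (Multiset.mem_add.2 (.inr hx)))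

/-- Elimination of a fresh nominal. -/
theorem NomFresh.le_or_anySat {j : N} (hj : NomFresh j Γ Δ) {x y : Val P S}
    (h : ∀ F, (Val.filter F).Le x → AllSat (assign f j F) g Γ →
      (Val.filter F).Le y ∨ AnySat (assign f j F) g Δ) (hΓ : AllSat f g Γ) :
    x.Le y ∨ AnySat f g Δ := by
  -- The disjunct supplied by `h` may vary with `F`. Since the truth of `Δ` does not depend on the
  -- fresh nominal, it is decided before `F` is chosen.
  by_cases hΔ : AnySat f g Δ
  · exact .inr hΔ
  · refine .inl (Val.le_of_forall_filter fun F hF => ?_)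
    exact (h F hF ((hj.allSat F).2 hΓ)).resolve_right fun h' => hΔ ((hj.anySat F).1 h')

/-- Elimination of a fresh conominal. -/
theorem ConFresh.le_or_anySat {m : M} (hm : ConFresh m Γ Δ) {x y : Val P S}
    (h : ∀ I, y.Le (.ideal I) → AllSat f (assign g m I) Γ →
      x.Le (.ideal I) ∨ AnySat f (assign g m I) Δ) (hΓ : AllSat f g Γ) :
    x.Le y ∨ AnySat f g Δ := by
  by_cases hΔ : AnySat f g Δ
  · exact .inr hΔ
  · refine .inl (Val.le_of_forall_ideal fun I hI => ?_)
    exact (h I hI ((hm.allSat I).2 hΓ)).resolve_right fun h' => hΔ ((hm.anySat I).1 h')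

/-! ### Truth of the displayed structures -/

theorem sat_jForm {j : N} {A : Form P} {o : Mark} :
    (jForm j A o : Occ P N M).1.Sat f g ↔ A ∈ (f j).carrier := Val.filter_le_form

theorem sat_mForm {A : Form P} {m : M} {o : Mark} :
    (mForm A m o : Occ P N M).1.Sat f g ↔ A ∈ (g m).carrier := Val.form_le_ideal

theorem sat_jLeM {j : N} {m : M} :
    (jLeM j m : Occ P N M).1.Sat f g ↔ ∃ A ∈ (f j).carrier, A ∈ (g m).carrier := Iff.rfl

/-- Upward closure of the filter absorbs the intermediate formula. The resulting condition is
literally that of `⧫j ≤ m`, which is the adjunction between ⧫ and □; `sat_diaLeM` and `sat_jLeBBox`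
are the dual pair. -/
theorem sat_jLeBox {j : N} {m : M} :
    (jLeBox j m : Occ P N M).1.Sat f g ↔ ∃ A, .box A ∈ (f j).carrier ∧ A ∈ (g m).carrier := by
  constructor
  · rintro ⟨B, hB, A, hA, h⟩
    exact ⟨A, (f j).mem_of_thm hB h, hA⟩
  · rintro ⟨A, hA, hm⟩
    exact ⟨_, hA, A, hm, .refl _⟩

theorem sat_bdiaLeM {j : N} {m : M} :
    (bdiaLeM j m : Occ P N M).1.Sat f g ↔ ∃ A, .box A ∈ (f j).carrier ∧ A ∈ (g m).carrier :=
  Iff.rfl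

theorem sat_diaLeM {j : N} {m : M} :
    (diaLeM j m : Occ P N M).1.Sat f g ↔ ∃ A, A ∈ (f j).carrier ∧ .dia A ∈ (g m).carrier := by
  constructor
  · rintro ⟨B, ⟨A, hA, h⟩, hB⟩
    exact ⟨A, hA, (g m).mem_of_thm hB h⟩
  · rintro ⟨A, hA, hm⟩
    exact ⟨_, ⟨A, hA, .refl _⟩, hm⟩

theorem sat_jLeBBox {j : N} {m : M} :
    (jLeBBox j m : Occ P N M).1.Sat f g ↔ ∃ A, A ∈ (f j).carrier ∧ .dia A ∈ (g m).carrier :=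
  Iff.rfl

/-- Testing the generators ◇A suffices, again by upward closure. -/
theorem sat_jLeDia {h j : N} {hj : j ≠ h} :
    (jLeDia h j hj : Occ P N M).1.Sat f g ↔ ∀ A ∈ (f j).carrier, .dia A ∈ (f h).carrier := by
  constructor
  · exact fun H A hA => H ⟨A, hA, .refl _⟩
  · rintro H B ⟨A, hA, hB⟩
    exact (f h).mem_of_thm (H A hA) hB

theorem sat_jLeBDia {k j : N} {hk : j ≠ k} :
    (jLeBDia k j hk : Occ P N M).1.Sat f g ↔ (f j).bdia.carrier ⊆ (f k).carrier := Iff.rfl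

end Semantics

/-! ## Soundness -/

variable {P N M : Type*} {S : Set Axm}

/-- The premise of the rules for `(D)` and `(C)` provides a formula `A` with `□A` in the filter of
`j` and `◇A` in the ideal of `m`. -/
theorem NomFresh.exists_box_dia {f : N → FormFilter P S} {g : M → FormIdeal P S}
    {Γ Δ : Multiset (Occ P N M)} {k j : N} {m : M} {hk : j ≠ k} (hkf : NomFresh k Γ Δ)
    (h : ∀ f : N → FormFilter P S, AllSat f g (jLeBDia k j hk ::ₘ Γ) →
      AnySat f g (diaLeM k m ::ₘ Δ)) (hΓ : AllSat f g Γ) :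
    (∃ A, .box A ∈ (f j).carrier ∧ .dia A ∈ (g m).carrier) ∨ AnySat f g Δ := by
  -- The fresh `k` takes the largest value allowed by `k ≤ ⧫j`, namely ⧫j itself. A formula `A`
  -- witnessing `◇k ≤ m` then has `□A` in the filter of `j`.
  have H := h (assign f k (f j).bdia)
  rw [allSat_cons, anySat_cons, hkf.allSat, hkf.anySat, sat_jLeBDia, sat_diaLeM, assign_self,
    assign_of_ne f _ hk] at H
  exact H ⟨subset_rfl, hΓ⟩

/-- Every derivable sequent is true under every assignment of filters to nominals and ideals to
conominals. -/
theorem Deriv.sound {Γ Δ : Multiset (Occ P N M)} (d : Deriv S Γ Δ) (f : N → FormFilter P S)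
    (g : M → FormIdeal P S) (hΓ : AllSat f g Γ) : AnySat f g Δ := by
  induction d generalizing f g with
  | id_j | id_top =>
    rw [allSat_singleton, sat_jForm] at hΓ
    exact anySat_singleton.2 (sat_jForm.2 hΓ)
  | id_m | id_bot =>
    rw [allSat_singleton, sat_mForm] at hΓ
    exact anySat_singleton.2 (sat_mForm.2 hΓ)
  | bot_j j A =>
    rw [allSat_singleton, sat_jForm] at hΓ
    exact anySat_singleton.2 (sat_jForm.2 ((f j).mem_of_thm hΓ (.bot_le A)))
  | bot_m m B => exact anySat_singleton.2 (sat_mForm.2 (g m).bot_mem)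
  | top_m m B =>
    rw [allSat_singleton, sat_mForm] at hΓ
    exact anySat_singleton.2 (sat_mForm.2 ((g m).mem_of_thm hΓ (.le_top B)))
  | top_j j A => exact anySat_singleton.2 (sat_jForm.2 (f j).top_mem)
  | cut_j j A _ _ _ _ ih ih' =>
    rw [allSat_add] at hΓ
    rw [anySat_add]
    rcases anySat_cons.1 (ih f g hΓ.1) with h | h
    · exact .inr (ih' f g (allSat_cons.2 ⟨h, hΓ.2⟩))
    · exact .inl h
  | cut_m B m _ _ _ _ ih ih' =>
    rw [allSat_add] at hΓ
    rw [anySat_add]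
    rcases anySat_cons.1 (ih f g hΓ.1) with h | h
    · exact .inr (ih' f g (allSat_cons.2 ⟨h, hΓ.2⟩))
    · exact .inl h
  | s_m j m A o _ hj ih =>
    simp only [anySat_cons, mForm, Struc.Sat]
    -- Join-density: every filter below `A` lies below the ideal of `m`, unless `Δ` holds.
    refine hj.le_or_anySat (fun F hF hΓ' => ?_) hΓ
    have H := ih (assign f j F) g
    simp only [allSat_cons, anySat_cons, jLeM, jTerm, jForm, Struc.Sat, LTerm.val,
      assign_self] at H
    exact H ⟨hF, hΓ'⟩
  | s_j j m A o _ hm ih =>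
    simp only [anySat_cons, jForm, Struc.Sat]
    refine hm.le_or_anySat (fun I hI hΓ' => ?_) hΓ
    have H := ih f (assign g m I)
    simp only [allSat_cons, anySat_cons, jLeM, jTerm, mForm, Struc.Sat, LTerm.val,
      assign_self] at H
    exact H ⟨hI, hΓ'⟩
  | s_mm j m A B o o' _ hj _ ih =>
    simp only [allSat_cons, anySat_cons, mForm, Struc.Sat] at hΓ ⊢
    -- Density yields `A ≤ B`, which is composed with the assumed `B ≤ m`. The remaining switch
    -- rules follow this pattern or its dual, and a term keeps its value because the reassigned
    -- variable does not occur in it.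
    refine (hj.le_or_anySat (fun F hF hΓ' => ?_) hΓ.2).imp_left (·.trans hΓ.1)
    have H := ih (assign f j F) g
    simp only [allSat_cons, anySat_cons, jForm, Struc.Sat, assign_self] at H
    exact H ⟨hF, hΓ'⟩
  | s_jj j m A B o o' _ _ hm ih =>
    simp only [allSat_cons, anySat_cons, jForm, Struc.Sat] at hΓ ⊢
    refine (hm.le_or_anySat (fun I hI hΓ' => ?_) hΓ.2).imp_left hΓ.1.trans
    have H := ih f (assign g m I)
    simp only [allSat_cons, anySat_cons, mForm, Struc.Sat, assign_self] at H
    exact H ⟨hI, hΓ'⟩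
  | s_mT j m A o T hTj hTm _ hj _ ih =>
    simp only [allSat_cons, anySat_cons, mForm, mTerm, Struc.Sat] at hΓ ⊢
    refine (hj.le_or_anySat (fun F hF hΓ' => ?_) hΓ.2).imp_left (·.trans hΓ.1)
    have H := ih (assign f j F) g
    simp only [allSat_cons, anySat_cons, jForm, jTerm, Struc.Sat, LTerm.val_assign_nom hTj] at H
    simp only [LTerm.val, assign_self] at H
    exact H ⟨hF, hΓ'⟩
  | s_jT j m A o T hTj hTm _ _ hm ih =>
    simp only [allSat_cons, anySat_cons, jForm, jTerm, Struc.Sat] at hΓ ⊢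
    refine (hm.le_or_anySat (fun I hI hΓ' => ?_) hΓ.2).imp_left hΓ.1.trans
    have H := ih f (assign g m I)
    simp only [allSat_cons, anySat_cons, mForm, mTerm, Struc.Sat, LTerm.val_assign_con hTm] at H
    simp only [LTerm.val, assign_self] at H
    exact H ⟨hI, hΓ'⟩
  | s_Tm j m A o T hTj hTm _ hj _ ih =>
    simp only [allSat_cons, anySat_cons, mForm, mTerm, Struc.Sat] at hΓ ⊢
    refine (hj.le_or_anySat (fun F hF hΓ' => ?_) hΓ.2).imp_left (·.trans hΓ.1)
    have H := ih (assign f j F) g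
    simp only [allSat_cons, anySat_cons, jForm, jTerm, Struc.Sat, LTerm.val_assign_nom hTj] at H
    simp only [LTerm.val, assign_self] at H
    exact H ⟨hF, hΓ'⟩
  | s_Tj j m A o T hTj hTm _ _ hm ih =>
    simp only [allSat_cons, anySat_cons, jForm, jTerm, Struc.Sat] at hΓ ⊢
    refine (hm.le_or_anySat (fun I hI hΓ' => ?_) hΓ.2).imp_left hΓ.1.trans
    have H := ih f (assign g m I)
    simp only [allSat_cons, anySat_cons, mForm, mTerm, Struc.Sat, LTerm.val_assign_con hTm] at H
    simp only [LTerm.val, assign_self] at H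
    exact H ⟨hI, hΓ'⟩
  | s_TTm j m T T' hTj hTm hTj' hTm' _ hj _ ih =>
    simp only [allSat_cons, anySat_cons, mTerm, Struc.Sat] at hΓ ⊢
    refine (hj.le_or_anySat (fun F hF hΓ' => ?_) hΓ.2).imp_left (·.trans hΓ.1)
    have H := ih (assign f j F) g
    simp only [allSat_cons, anySat_cons, jTerm, Struc.Sat, LTerm.val_assign_nom hTj,
      LTerm.val_assign_nom hTj'] at H
    simp only [LTerm.val, assign_self] at H
    exact H ⟨hF, hΓ'⟩
  | s_jTT j m T T' hTj hTm hTj' hTm' _ _ hm ih =>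
    simp only [allSat_cons, anySat_cons, jTerm, Struc.Sat] at hΓ ⊢
    refine (hm.le_or_anySat (fun I hI hΓ' => ?_) hΓ.2).imp_left hΓ.1.trans
    have H := ih f (assign g m I)
    simp only [allSat_cons, anySat_cons, mTerm, Struc.Sat, LTerm.val_assign_con hTm,
      LTerm.val_assign_con hTm'] at H
    simp only [LTerm.val, assign_self] at H
    exact H ⟨hI, hΓ'⟩
  | adj_dia j m _ ih | adj_dia_inv j m _ ih =>
    have H := ih f g hΓ
    rw [anySat_cons, sat_jLeBBox, sat_diaLeM] at *
    exact H
  | adj_box j m _ ih | adj_box_inv j m _ ih =>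
    have H := ih f g hΓ
    rw [anySat_cons, sat_jLeBox, sat_bdiaLeM] at *
    exact H
  | top_box j m o o' _ _ ih =>
    rw [allSat_cons] at hΓ
    refine anySat_cons.2 ((anySat_cons.1 (ih f g hΓ.2)).imp_left fun h => ?_)
    -- The witness is ⊤, since every filter contains □⊤.
    exact sat_jLeBox.2 ⟨.top, (f j).mem_of_thm (f j).top_mem .top_le_box, sat_mForm.1 h⟩
  | bot_dia j m o o' _ _ ih =>
    rw [allSat_cons] at hΓ
    refine anySat_cons.2 ((anySat_cons.1 (ih f g hΓ.2)).imp_left fun h => ?_)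
    exact sat_diaLeM.2 ⟨.bot, sat_jForm.1 h, (g m).mem_of_thm (g m).bot_mem .dia_bot_le⟩
  | and_P_left j A B o o' _ _ _ ih =>
    rw [allSat_cons, sat_jForm] at hΓ
    exact ih f g (allSat_cons.2
      ⟨sat_jForm.2 ((f j).mem_of_thm hΓ.1 (.and_le_left A B)), hΓ.2⟩)
  | and_P_right j A B o o' _ _ _ ih =>
    rw [allSat_cons, sat_jForm] at hΓ
    exact ih f g (allSat_cons.2
      ⟨sat_jForm.2 ((f j).mem_of_thm hΓ.1 (.and_le_right A B)), hΓ.2⟩)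
  | and_S j A B _ _ _ _ _ _ _ ih ih' =>
    have h := ih f g hΓ
    have h' := ih' f g hΓ
    rw [anySat_cons, sat_jForm] at *
    exact h.elim (fun h => h'.imp_left ((f j).and_mem h)) .inr
  | or_P m A B _ _ _ _ _ _ _ ih ih' =>
    have h := ih f g hΓ
    have h' := ih' f g hΓ
    rw [anySat_cons, sat_mForm] at *
    exact h.elim (fun h => h'.imp_left ((g m).or_mem h)) .inr
  | or_S_left m A B o o' _ _ _ ih =>
    rw [allSat_cons, sat_mForm] at hΓ
    exact ih f g (allSat_cons.2
      ⟨sat_mForm.2 ((g m).mem_of_thm hΓ.1 (.le_or_left A B)), hΓ.2⟩)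
  | or_S_right m A B o o' _ _ _ ih =>
    rw [allSat_cons, sat_mForm] at hΓ
    exact ih f g (allSat_cons.2
      ⟨sat_mForm.2 ((g m).mem_of_thm hΓ.1 (.le_or_right A B)), hΓ.2⟩)
  | box_P j m A o o' _ _ _ ih =>
    rw [allSat_cons, sat_jForm] at hΓ
    refine anySat_cons.2 ((anySat_cons.1 (ih f g hΓ.2)).imp_left fun h => ?_)
    exact sat_jLeBox.2 ⟨A, hΓ.1, sat_mForm.1 h⟩
  | box_S j m A o o' _ _ hm _ ih =>
    -- One ideal suffices here: for the principal ideal of `A`, the premise gives `□B` in the filter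
    -- of `j` with `B ⊢ A`, unless `Δ` holds.
    have H := ih f (assign g m (.principal S A))
    rw [allSat_cons, anySat_cons, hm.allSat, hm.anySat, sat_mForm, sat_jLeBox, assign_self] at H
    refine anySat_cons.2 ((H ⟨.refl A, hΓ⟩).imp_left ?_)
    rintro ⟨B, hB, hBA⟩
    exact sat_jForm.2 ((f j).mem_of_thm hB (.box_mono hBA))
  | dia_P j m A o o' _ _ hj _ ih =>
    have H := ih (assign f j (.principal S A)) g
    rw [allSat_cons, anySat_cons, hj.allSat, hj.anySat, sat_jForm, sat_diaLeM, assign_self] at H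
    refine anySat_cons.2 ((H ⟨.refl A, hΓ⟩).imp_left ?_)
    rintro ⟨B, hAB, hB⟩
    exact sat_mForm.2 ((g m).mem_of_thm hB (.dia_mono hAB))
  | dia_S j m A o o' _ _ _ ih =>
    rw [allSat_cons, sat_mForm] at hΓ
    refine anySat_cons.2 ((anySat_cons.1 (ih f g hΓ.2)).imp_left fun h => ?_)
    exact sat_diaLeM.2 ⟨A, sat_jForm.1 h, hΓ.1⟩
  | rule4 hS h j m hj _ ih =>
    rw [allSat_cons, sat_jLeDia] at hΓ
    refine anySat_cons.2 ((anySat_cons.1 (ih f g hΓ.2)).imp_left fun H => ?_)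
    obtain ⟨A, hA, hm⟩ := sat_diaLeM.1 H
    -- The new witness is ◇A: axiom (4) puts ◇◇A into the ideal of `m`, below ◇A.
    exact sat_diaLeM.2 ⟨.dia A, hΓ.1 A hA, (g m).mem_of_thm hm (.ax .ax4 hS A)⟩
  | ruleT hS j m _ ih =>
    refine anySat_cons.2 ((anySat_cons.1 (ih f g hΓ)).imp_left fun H => ?_)
    obtain ⟨A, hA, hm⟩ := sat_jLeBox.1 H
    exact sat_jLeM.2 ⟨A, (f j).mem_of_thm hA (.ax .axT hS A), hm⟩
  | ruleB hS j m _ ih =>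
    refine anySat_cons.2 ((anySat_cons.1 (ih f g hΓ)).imp_left fun H => ?_)
    obtain ⟨A, hA, hm⟩ := sat_diaLeM.1 H
    exact sat_jLeBox.2 ⟨.dia A, (f j).mem_of_thm hA (.ax .axB hS A), hm⟩
  | ruleD hS k j m hk _ hkf ih =>
    refine anySat_cons.2 ((hkf.exists_box_dia (fun f => ih f g) hΓ).imp_left ?_)
    rintro ⟨A, hA, hm⟩
    exact sat_jLeM.2 ⟨.dia A, (f j).mem_of_thm hA (.ax .axD hS A), hm⟩
  | ruleC hS k h j m hk hj _ hkf ih =>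
    rw [allSat_cons, sat_jLeDia] at hΓ
    refine anySat_cons.2 ((hkf.exists_box_dia (fun f => ih f g) hΓ.2).imp_left ?_)
    rintro ⟨A, hA, hm⟩
    -- From `h ≤ ◇j` and `□A` in the filter of `j`, the filter of `h` contains ◇□A, hence □◇A by
    -- (C).
    exact sat_bdiaLeM.2 ⟨.dia A, (f h).mem_of_thm (hΓ.1 _ hA) (.ax .axC hS A), hm⟩

end NDModal

/-! ### Conservativity -/

theorem mainTheorem4 {P N M : Type*} (S : Set NDModal.Axm) (A B : NDModal.Form P) (j : N)
    (h : NDModal.Derivable S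
      {(NDModal.Struc.nomForm j A : NDModal.Struc P N M)} {NDModal.Struc.nomForm j B}) :
    NDModal.LThm S A B := by
  obtain ⟨Γ, Δ, hΓ, hΔ, d⟩ := h
  obtain ⟨x, rfl, hx⟩ := Multiset.map_eq_singleton.1 hΓ
  obtain ⟨y, rfl, hy⟩ := Multiset.map_eq_singleton.1 hΔ
  -- Only the value at `j` matters; no conominal occurs in the sequent, so the choice of ideal is
  -- arbitrary.
  have H := d.sound (fun _ => .principal S A) (fun _ => .principal S A)
  rw [NDModal.allSat_singleton, NDModal.anySat_singleton, hx, hy] at H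
  exact NDModal.Val.filter_le_form.1 (H (NDModal.Val.filter_le_form.2 (.refl A)))
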